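/- \textbf{Conventions.} Let $f\colon X\to Y$ be a continuous map between locally compact Hausdorff spaces. Let $\mathrm{pr}(f)\subseteq Y$ be the union of all open $W\subseteq Y$ such that $\overline W$ and $f^{-1}(\overline W)$ are compact. A \emph{fibrewise compactification} of $f$ is a pair $(Z,g)$ of a locally compact Hausdorff space $Z$ and a continuous proper map $g\colon Z\to Y$ for which there is an open inclusion (open topological embedding) $\iota\colon X\to Z$ with $g\circ\iota=f$ such that $g$ restricts to a homeomorphism of $Z\setminus\overline{\iota(X)}$ onto a subset of $\mathrm{pr}(f)$ that is closed in the subspace topology of $\mathrm{pr}(f)$. It is a \emph{perfection} if moreover $g$ is surjective. For $C^*$-algebras $A,B$, let $\mathrm{Mor}(A,B)$ be the set of $*$-homomorphisms $\varphi\colon A\to\mathcal M(B)$ into the multiplier algebra of $B$ for which $\operatorname{span}\{\varphi(a)b : a\in A,\ b\in B\}$ is dense in $B$. A $*$-homomorphism $\psi\colon A\to C$ is a \emph{proper morphism} if $\operatorname{span}\{\psi(a)c : a\in A,\ c\in C\}$ is dense in $C$. A \emph{noncommutative fibrewise compactification} of $\varphi\in\mathrm{Mor}(A,B)$ is a pair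 $(C,\psi)$ of a $C^*$-algebra $C$ and a proper morphism $\psi\colon A\to C$ such that $B$ is isomorphic to (and is identified with) a closed two-sided ideal of $C$ for which (i) $\alpha\circ\psi=\varphi$, where $\alpha\colon C\to\mathcal M(B)$ is the $*$-homomorphism with $\alpha(c)b=cb$; and (ii) the image of $\varphi^{-1}(B)\to C/B$, $a\mapsto\psi(a)+B$, contains $\{c+B : c\in B^\perp\}$, where $B^\perp=\{c\in C : cb=0\text{ for all }b\in B\}$. It is a \emph{(noncommutative) perfection} if moreover $\psi$ is injective. Write $f^*\colon C_0(Y)\to C_b(X)\cong\mathcal M(C_0(X))$, $f^*(a)=a\circ f$; for a continuous proper map $g\colon Z\to Y$ write $g^*\colon C_0(Y)\to C_0(Z)$, $g^*(a)=a\circ g$. For a $C^*$-algebra $C$ let $\widehat C$ be the space of nonzero $*$-homomorphisms $C\to\mathbb C$ with the weak$^*$ topology, and for a proper morphism $\psi\colon C_0(Y)\to C$ let $\psi_*\colon\widehat C\to\widehat{C_0(Y)}\cong Y$ be the map $\chi\mapsto\chi\circ\psi$, so that $a(\psi_*(\chi))=\chi(\psi(a))$ for all $a\in C_0(Y)$.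 \textbf{Proposition.} Let $f\colon X\to Y$ be a continuous map between locally compact Hausdorff spaces. Then $f^*\in\mathrm{Mor}(C_0(Y),C_0(X))$, and: \begin{enumerate} \item If $(Z,g)$ is a fibrewise compactification (respectively, a perfection) of $f$, then $(C_0(Z),g^*)$ is a noncommutative fibrewise compactification (respectively, perfection) of $f^*$. \item Conversely, if $(C,\psi)$ is a noncommutative fibrewise compactification (respectively, perfection) of $f^*$, then $C$ is commutative and $(\widehat C,\psi_*)$ is a fibrewise compactification (respectively, a perfection) of $f$. \end{enumerate} -/

import Mathlib

open Set Filter Topology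
open scoped ZeroAtInfty BoundedContinuousFunction MultiplierAlgebra

noncomputable section

namespace FibrewiseCompactification

/-! ### Fibrewise compactifications of continuous maps -/

section Topological

variable {X Y Z : Type*} [TopologicalSpace X] [TopologicalSpace Y] [TopologicalSpace Z]

/-- The set `pr(f)`: the union of all precompact open `W ⊆ Y` such that the preimage under `f` of
the closure of `W` is compact. -/
def pr (f : X → Y) : Set Y :=
  ⋃₀ {W : Set Y | IsOpen W ∧ IsCompact (closure W) ∧ IsCompact (f ⁻¹' closure W)}

/-- `(Z, g)` is a fibrewise compactification of `f : X → Y` (a continuous map between locally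
compact Hausdorff spaces): `Z` is locally compact Hausdorff, `g : Z → Y` is continuous and proper,
and there is an open inclusion `ι : X → Z` such that `g ∘ ι = f` and such that the restriction of
`g` to the complement of the closure of `ι(X)` is a homeomorphism onto a subset of `pr(f)` that is
closed in the subspace topology of `pr(f)`. -/
structure IsFibrewiseCompactification (f : X → Y) (g : Z → Y) : Prop where
  t2Space : T2Space Z
  locallyCompactSpace : LocallyCompactSpace Z
  isProperMap : IsProperMap g
  exists_openInclusion : ∃ ι : X → Z, IsOpenEmbedding ι ∧ g ∘ ι = f ∧
    IsEmbedding (((closure (range ι))ᶜ : Set Z).domRestrict g) ∧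
    g '' (closure (range ι))ᶜ ⊆ pr f ∧
    IsClosed ((↑) ⁻¹' (g '' (closure (range ι))ᶜ) : Set (pr f))

/-- A perfection is a fibrewise compactification `(Z, g)` with `g` surjective. -/
structure IsPerfection (f : X → Y) (g : Z → Y) : Prop
    extends IsFibrewiseCompactification f g where
  surjective : Function.Surjective g

end Topological

/-! ### Morphisms of `C*`-algebras and noncommutative fibrewise compactifications -/

section CStar

variable {A B C : Type*} [NonUnitalCStarAlgebra A] [NonUnitalCStarAlgebra B]
  [NonUnitalCStarAlgebra C]

/-- A `*`-homomorphism `φ : A → M(B)` belongs to `Mor(A, B)` if the linear span of the products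
`φ(a) b` is dense in `B`. (A multiplier `m` acts on `B` from the left as `m.fst`.) -/
def IsMorphism (φ : A →⋆ₙₐ[ℂ] 𝓜(ℂ, B)) : Prop :=
  Dense (Submodule.span ℂ {x : B | ∃ (a : A) (b : B), x = (φ a).fst b} : Set B)

/-- A `*`-homomorphism `ψ : A → C` is a proper morphism from `A` to `C` if, viewed as a map into
`M(C)`, it belongs to `Mor(A, C)`. -/
def IsProperMorphism (ψ : A →⋆ₙₐ[ℂ] C) : Prop :=
  IsMorphism ((DoubleCentralizer.coeHom (𝕜 := ℂ) (A := C)).comp ψ)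

/-- `j` is an isomorphism of `B` onto a (norm-closed, two-sided) ideal of `C`. -/
structure IsIdealInclusion (j : B →⋆ₙₐ[ℂ] C) : Prop where
  injective : Function.Injective j
  isClosed_range : IsClosed (range j)
  mul_left_mem : ∀ (c : C) (b : B), c * j b ∈ range j
  mul_right_mem : ∀ (c : C) (b : B), j b * c ∈ range j

/-- The annihilator `{c | c b = 0 for all b ∈ I}` of a subset `I` of `C`. -/
def annihilator (I : Set C) : Set C := {c | ∀ b ∈ I, c * b = 0}

/-- The Pimsner ideal `φ⁻¹(B)` of `φ : A → M(B)`. -/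
def pimsnerIdeal (φ : A →⋆ₙₐ[ℂ] 𝓜(ℂ, B)) : Set A :=
  φ ⁻¹' range (DoubleCentralizer.coeHom (𝕜 := ℂ) (A := B))

namespace IsIdealInclusion

variable {j : B →⋆ₙₐ[ℂ] C}

/-- Left multiplication by `c ∈ C` on the ideal `B`: the operator `b ↦ j⁻¹ (c (j b))`. -/
def leftMul (h : IsIdealInclusion j) (c : C) : B →L[ℂ] B :=
  let F : B → B := fun b => Classical.choose (h.mul_left_mem c b)
  have hF : ∀ b, j (F b) = c * j b := fun b => Classical.choose_spec (h.mul_left_mem c b)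
  LinearMap.mkContinuous
    { toFun := F
      map_add' := fun x y => h.injective <| by rw [map_add, hF, hF, hF, map_add, mul_add]
      map_smul' := fun r x => h.injective <| by
        rw [RingHom.id_apply, map_smul, hF, hF, map_smul, mul_smul_comm] }
    ‖c‖ fun b => by
      rw [← NonUnitalStarAlgHom.norm_map j h.injective,
        ← NonUnitalStarAlgHom.norm_map j h.injective b]
      exact (congrArg norm (hF b)).trans_le (norm_mul_le _ _)

/-- Right multiplication by `c ∈ C` on the ideal `B`: the operator `b ↦ j⁻¹ ((j b) c)`. -/
def rightMul (h : IsIdealInclusion j) (c : C) : B →L[ℂ] B :=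
  let F : B → B := fun b => Classical.choose (h.mul_right_mem c b)
  have hF : ∀ b, j (F b) = j b * c := fun b => Classical.choose_spec (h.mul_right_mem c b)
  LinearMap.mkContinuous
    { toFun := F
      map_add' := fun x y => h.injective <| by rw [map_add, hF, hF, hF, map_add, add_mul]
      map_smul' := fun r x => h.injective <| by
        rw [RingHom.id_apply, map_smul, hF, hF, map_smul, smul_mul_assoc] }
    ‖c‖ fun b => by
      rw [← NonUnitalStarAlgHom.norm_map j h.injective,
        ← NonUnitalStarAlgHom.norm_map j h.injective b, mul_comm]
      exact (congrArg norm (hF b)).trans_le (norm_mul_le _ _)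

theorem map_leftMul (h : IsIdealInclusion j) (c : C) (b : B) : j (h.leftMul c b) = c * j b :=
  Classical.choose_spec (h.mul_left_mem c b)

theorem map_rightMul (h : IsIdealInclusion j) (c : C) (b : B) : j (h.rightMul c b) = j b * c :=
  Classical.choose_spec (h.mul_right_mem c b)

/-- The `*`-homomorphism `α : C → M(B)` induced by an inclusion `j` of `B` as an ideal of `C`: the
multiplier `α(c)` acts by `j (α(c) b) = c (j b)` and `j (b α(c)) = (j b) c`. -/
def inducedMorphism (h : IsIdealInclusion j) : C →⋆ₙₐ[ℂ] 𝓜(ℂ, B) where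
  toFun c :=
    { fst := h.leftMul c
      snd := h.rightMul c
      central := fun x y => h.injective <| by
        simp only [map_mul, map_leftMul, map_rightMul, mul_assoc] }
  map_smul' r c := by
    ext b
    · exact h.injective (by simp [map_leftMul, smul_mul_assoc])
    · exact h.injective (by simp [map_rightMul, mul_smul_comm])
  map_zero' := by
    ext b
    · exact h.injective (by simp [map_leftMul])
    · exact h.injective (by simp [map_rightMul])
  map_add' c d := by
    ext b
    · exact h.injective (by simp [map_leftMul, add_mul])
    · exact h.injective (by simp [map_rightMul, mul_add])
  map_mul' c d := by
    ext b
    · exact h.injective (by simp [map_leftMul, mul_assoc])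
    · exact h.injective (by simp [map_rightMul, mul_assoc])
  map_star' c := by
    ext b
    · exact h.injective (by simp [map_leftMul, map_rightMul, map_star])
    · exact h.injective (by simp [map_leftMul, map_rightMul, map_star])

end IsIdealInclusion

/-- `(C, ψ)` is a (noncommutative) fibrewise compactification of `φ ∈ Mor(A, B)`: `ψ` is a proper
morphism from `A` to `C`, and `B` is isomorphic, via some `j`, to an ideal of `C` such that
`α ∘ ψ = φ` for the induced `α : C → M(B)`, and such that the image of
`ψ̄ : φ⁻¹(B) → C/B`, `ψ̄(a) = ψ(a) + B`, contains `c + B` for every `c` in the annihilator of `B`. -/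
structure IsNCFibrewiseCompactification (φ : A →⋆ₙₐ[ℂ] 𝓜(ℂ, B)) (ψ : A →⋆ₙₐ[ℂ] C) : Prop where
  isProperMorphism : IsProperMorphism ψ
  exists_idealInclusion : ∃ (j : B →⋆ₙₐ[ℂ] C) (h : IsIdealInclusion j),
    h.inducedMorphism.comp ψ = φ ∧
    ∀ c ∈ annihilator (range j), ∃ a ∈ pimsnerIdeal φ, ψ a - c ∈ range j

/-- A (noncommutative) perfection is a fibrewise compactification `(C, ψ)` with `ψ` injective. -/
structure IsNCPerfection (φ : A →⋆ₙₐ[ℂ] 𝓜(ℂ, B)) (ψ : A →⋆ₙₐ[ℂ] C) : Prop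
    extends IsNCFibrewiseCompactification φ ψ where
  injective : Function.Injective ψ

end CStar

/-! ### The `*`-homomorphisms induced by continuous maps -/

section Pullback

variable {X Y Z : Type*} [TopologicalSpace X] [TopologicalSpace Y] [TopologicalSpace Z]

/-- Multiplication by a bounded continuous function, as an operator on `C₀(X)`. -/
def mulBounded (h : X →ᵇ ℂ) : C₀(X, ℂ) →L[ℂ] C₀(X, ℂ) :=
  LinearMap.mkContinuous
    { toFun := fun b =>
        { toFun := fun x => h x * b x
          continuous_toFun := h.continuous.mul b.continuous
          zero_at_infty' := by
            refine squeeze_zero_norm (a := fun x => ‖h‖ * ‖b x‖) (fun x => ?_) ?_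
            · rw [norm_mul]
              exact mul_le_mul_of_nonneg_right (h.norm_coe_le_norm x) (norm_nonneg _)
            · simpa using (b.zero_at_infty'.norm).const_mul ‖h‖ }
      map_add' := fun b c => by ext x; exact mul_add _ _ _
      map_smul' := fun r b => by ext x; exact mul_left_comm _ _ _ }
    ‖h‖ fun b => by
      rw [← ZeroAtInftyContinuousMap.norm_toBCF_eq_norm,
        BoundedContinuousFunction.norm_le (by positivity)]
      intro x
      refine (norm_mul_le (h x) (b x)).trans ?_
      exact mul_le_mul (h.norm_coe_le_norm x)
        ((b.toBCF.norm_coe_le_norm x).trans_eq ZeroAtInftyContinuousMap.norm_toBCF_eq_norm)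
        (norm_nonneg _) (norm_nonneg _)

/-- For a continuous map `f : X → Y`, the `*`-homomorphism `f* : C₀(Y) → M(C₀(X))` that sends `a`
to (multiplication by) the bounded continuous function `a ∘ f`. -/
def pullback (f : C(X, Y)) : C₀(Y, ℂ) →⋆ₙₐ[ℂ] 𝓜(ℂ, C₀(X, ℂ)) where
  toFun a :=
    { fst := mulBounded (a.toBCF.compContinuous f)
      snd := mulBounded (a.toBCF.compContinuous f)
      central := fun x y => by
        ext t; exact (mul_assoc _ _ _).trans (mul_left_comm _ _ _) }
  map_smul' r a := by
    ext b t
    · exact mul_assoc _ _ _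
    · exact mul_assoc _ _ _
  map_zero' := by
    ext b t
    · exact zero_mul _
    · exact zero_mul _
  map_add' a c := by
    ext b t
    · exact add_mul _ _ _
    · exact add_mul _ _ _
  map_mul' a c := by
    ext b t
    · exact mul_assoc _ _ _
    · exact (mul_assoc _ _ _).trans (mul_left_comm _ _ _)
  map_star' a := by
    ext b t
    · change star (a (f t)) * b t = star (a (f t) * star (b t))
      rw [star_mul, star_star, mul_comm]
    · change star (a (f t)) * b t = star (a (f t) * star (b t))
      rw [star_mul, star_star, mul_comm]

/-- For a continuous proper map `g : Z → Y`, the `*`-homomorphism `g* : C₀(Y) → C₀(Z)`,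
`g*(a) = a ∘ g`. -/
def properPullback (g : Z → Y) (hg : IsProperMap g) : C₀(Y, ℂ) →⋆ₙₐ[ℂ] C₀(Z, ℂ) where
  toFun a :=
    { toFun := fun z => a (g z)
      continuous_toFun := a.continuous.comp hg.continuous
      zero_at_infty' := a.zero_at_infty'.comp <|
        (hasBasis_cocompact.tendsto_right_iff).2 fun _ hK =>
          (hg.isCompact_preimage hK).compl_mem_cocompact }
  map_smul' _ _ := rfl
  map_zero' := rfl
  map_add' _ _ := rfl
  map_mul' _ _ := rfl
  map_star' _ := rfl

end Pullback

/-! ### Spectra -/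

section Spectrum

/-- For a proper morphism `ψ : A → C`, the map `χ ↦ χ ∘ ψ` from the spectrum of `C` to the spectrum
of `A`. -/
def spectrumMap {A C : Type*} [NonUnitalCStarAlgebra A] [NonUnitalCStarAlgebra C]
    (ψ : A →⋆ₙₐ[ℂ] C) (hψ : IsProperMorphism ψ) (χ : WeakDual.characterSpace ℂ C) :
    WeakDual.characterSpace ℂ A :=
  ⟨StrongDual.toWeakDual ((WeakDual.CharacterSpace.toCLM χ).comp
      (LinearMap.mkContinuous (ψ : A →ₗ[ℂ] C) 1 fun a => by
        simpa using NonUnitalStarAlgHom.norm_apply_le ψ a)), by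
    have key : ∀ a : A, (StrongDual.toWeakDual ((WeakDual.CharacterSpace.toCLM χ).comp
      (LinearMap.mkContinuous (ψ : A →ₗ[ℂ] C) 1 fun a => by
        simpa using NonUnitalStarAlgHom.norm_apply_le ψ a))) a = χ (ψ a) := fun _ => rfl
    refine ⟨fun h0 => χ.2.1 ?_, fun x y => by simp only [key, map_mul]⟩
    have hz : ∀ a, χ (ψ a) = 0 := fun a => by rw [← key, h0]; rfl
    have hle : ∀ c : C, c ∈ (Submodule.span ℂ {x : C | ∃ (a : A) (b : C), x =
        (((DoubleCentralizer.coeHom (𝕜 := ℂ) (A := C)).comp ψ) a).fst b} : Set C) → χ c = 0 := by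
      intro c hc
      induction hc using Submodule.span_induction with
      | mem x hx =>
        obtain ⟨a, b, rfl⟩ := hx
        change χ (ψ a * b) = 0
        rw [map_mul, hz, zero_mul]
      | zero => exact map_zero χ
      | add x y _ _ hx hy => rw [map_add, hx, hy, add_zero]
      | smul r x _ hx => rw [map_smul, hx, smul_zero]
    have hcl : IsClosed {c : C | χ c = 0} := isClosed_eq (map_continuous χ) continuous_const
    exact DFunLike.ext _ _ fun c => hcl.closure_subset_iff.2 hle (hψ c)⟩

theorem spectrumMap_apply {A C : Type*} [NonUnitalCStarAlgebra A] [NonUnitalCStarAlgebra C]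
    (ψ : A →⋆ₙₐ[ℂ] C) (hψ : IsProperMorphism ψ) (χ : WeakDual.characterSpace ℂ C) (a : A) :
    spectrumMap ψ hψ χ a = χ (ψ a) := rfl

variable {Y : Type*} [TopologicalSpace Y] [T2Space Y] [LocallyCompactSpace Y]

theorem exists_bump {U : Set Y} (hU : IsOpen U) {y : Y} (hy : y ∈ U) :
    ∃ a : C₀(Y, ℂ), a y = 1 ∧ ∀ z ∉ U, a z = 0 := by
  obtain ⟨f, hf1, hf0, hc, -⟩ := exists_continuous_one_zero_of_isCompact (isCompact_singleton (x := y))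
    hU.isClosed_compl (by simpa [disjoint_left] using hy)
  refine ⟨⟨⟨fun z => (f z : ℂ), by fun_prop⟩, ?_⟩, ?_, fun z hz => ?_⟩
  · have hc' : HasCompactSupport fun z => (f z : ℂ) :=
      hc.comp_left (g := fun r : ℝ => (r : ℂ)) Complex.ofReal_zero
    exact hc'.is_zero_at_infty
  · have := hf1 (mem_singleton y)
    simp only [Pi.one_apply] at this
    change (f y : ℂ) = 1
    rw [this, Complex.ofReal_one]
  · have := hf0 (show z ∈ Uᶜ from hz)
    simp only [Pi.zero_apply] at this
    change (f z : ℂ) = 0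
    rw [this, Complex.ofReal_zero]

/-- Evaluation at `y`, as a point of the spectrum of `C₀(Y)`. -/
def evalCharacter (y : Y) : WeakDual.characterSpace ℂ C₀(Y, ℂ) :=
  ⟨StrongDual.toWeakDual (LinearMap.mkContinuous
      { toFun := fun a : C₀(Y, ℂ) => a y, map_add' := fun _ _ => rfl, map_smul' := fun _ _ => rfl }
      1 fun a => by
        rw [one_mul, ← ZeroAtInftyContinuousMap.norm_toBCF_eq_norm]
        exact a.toBCF.norm_coe_le_norm y), by
    refine ⟨fun h0 => ?_, fun _ _ => rfl⟩
    obtain ⟨a, ha, -⟩ := exists_bump isOpen_univ (mem_univ y)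
    exact one_ne_zero (ha.symm.trans (DFunLike.congr_fun h0 a))⟩

theorem evalCharacter_apply (y : Y) (a : C₀(Y, ℂ)) : evalCharacter y a = a y := rfl

theorem exists_ker_le (χ : WeakDual.characterSpace ℂ C₀(Y, ℂ)) :
    ∃ y : Y, ∀ a : C₀(Y, ℂ), χ a = 0 → a y = 0 := by
  by_contra! hcon
  choose a ha hay using hcon
  obtain ⟨u, hu⟩ : ∃ u, χ u ≠ 0 := by
    by_contra! h
    exact χ.2.1 (DFunLike.ext _ _ h)
  obtain ⟨ε, hε, hball⟩ := Metric.mem_nhds_iff.1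
    ((isOpen_ne_fun (map_continuous χ) continuous_const).mem_nhds hu)
  obtain ⟨K, hK, hKu⟩ := mem_cocompact.1
    (u.zero_at_infty' (Metric.ball_mem_nhds (0 : ℂ) (half_pos hε)))
  obtain ⟨p, hp1, -, hpc, hp01⟩ := exists_continuous_one_zero_of_isCompact hK
    (isClosed_empty (X := Y)) (disjoint_empty K)
  have hwc : HasCompactSupport fun y => (p y : ℂ) * u y :=
    (hpc.comp_left (g := fun r : ℝ => (r : ℂ)) Complex.ofReal_zero).mul_right
  let w : C₀(Y, ℂ) := ⟨⟨fun y => (p y : ℂ) * u y, by fun_prop⟩, hwc.is_zero_at_infty⟩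
  have hw : χ w ≠ 0 := by
    refine hball ?_
    rw [Metric.mem_ball, ← ZeroAtInftyContinuousMap.dist_toBCF_eq_dist]
    refine lt_of_le_of_lt ((BoundedContinuousFunction.dist_le (half_pos hε).le).2 fun y => ?_)
      (half_lt_self hε)
    change dist ((p y : ℂ) * u y) (u y) ≤ ε / 2
    by_cases hy : y ∈ K
    · rw [hp1 hy]
      simpa using (half_pos hε).le
    · have h1 : ‖u y‖ < ε / 2 := by simpa using hKu hy
      have h2 : (p y : ℂ) * u y - u y = -((1 - p y : ℝ) : ℂ) * u y := by push_cast; ring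
      rw [dist_eq_norm, h2, norm_mul, norm_neg, Complex.norm_real, Real.norm_eq_abs,
        abs_of_nonneg (by linarith [(hp01 y).2])]
      nlinarith [(hp01 y).1, norm_nonneg (u y)]
  obtain ⟨t, -, ht⟩ := hwc.isCompact.elim_nhds_subcover (fun y => {z | a y z ≠ 0}) fun y _ =>
    (isOpen_ne_fun (a y).continuous continuous_const).mem_nhds (hay y)
  let h : C₀(Y, ℂ) := ∑ i ∈ t, star (a i) * a i
  have hh : χ h = 0 := by
    simp only [h, map_sum, map_mul, ha, mul_zero, Finset.sum_const_zero]
  let r : Y → ℝ := fun y => ∑ i ∈ t, ‖a i y‖ ^ 2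
  have hr : Continuous r := continuous_finsetSum _ fun i _ => ((a i).continuous.norm).pow 2
  have hhr : ∀ y, h y = (r y : ℂ) := fun y => by
    have : h y = ∑ i ∈ t, (star (a i) * a i) y :=
      map_sum (evalCharacter y) (fun i => star (a i) * a i) t
    rw [this]
    simp only [r, Complex.ofReal_sum]
    refine Finset.sum_congr rfl fun i _ => ?_
    change star (a i y) * a i y = _
    rw [Complex.star_def, mul_comm, Complex.mul_conj, Complex.normSq_eq_norm_sq]
  have hpos : ∀ y ∈ tsupport fun y => (p y : ℂ) * u y, 0 < r y := fun y hy => by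
    obtain ⟨i, hi, hiy⟩ := mem_iUnion₂.1 (ht hy)
    exact Finset.sum_pos' (fun _ _ => by positivity)
      ⟨i, hi, by have := norm_pos_iff.2 hiy; positivity⟩
  obtain ⟨m, hm, hmr⟩ := hwc.isCompact.exists_forall_le' hr.continuousOn hpos
  have hmax : ∀ y, ((max (r y) m : ℝ) : ℂ) ≠ 0 := fun y =>
    Complex.ofReal_ne_zero.2 (hm.trans_le (le_max_right _ _)).ne'
  have hqc : HasCompactSupport fun y => (p y : ℂ) * u y * ((max (r y) m : ℝ) : ℂ)⁻¹ :=
    hwc.mul_right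
  let q : C₀(Y, ℂ) := ⟨⟨fun y => (p y : ℂ) * u y * ((max (r y) m : ℝ) : ℂ)⁻¹,
    (by fun_prop : Continuous fun y => (p y : ℂ) * u y).mul
      ((Complex.continuous_ofReal.comp (hr.max continuous_const)).inv₀ hmax)⟩,
    hqc.is_zero_at_infty⟩
  have hwq : w = h * q := by
    ext y
    rw [ZeroAtInftyContinuousMap.mul_apply, hhr]
    change (p y : ℂ) * u y = r y * ((p y : ℂ) * u y * ((max (r y) m : ℝ) : ℂ)⁻¹)
    by_cases hy : y ∈ tsupport fun y => (p y : ℂ) * u y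
    · have hy' := hmax y
      rw [max_eq_left (hmr y hy)] at hy' ⊢
      field_simp
    · have h0 : (p y : ℂ) * u y = 0 :=
        image_eq_zero_of_notMem_tsupport (f := fun y => (p y : ℂ) * u y) hy
      rw [h0, zero_mul, mul_zero]
  exact hw (by rw [hwq, map_mul, hh, zero_mul])

theorem evalCharacter_bijective :
    Function.Bijective (evalCharacter : Y → WeakDual.characterSpace ℂ C₀(Y, ℂ)) := by
  refine ⟨fun y y' h => ?_, fun χ => ?_⟩
  · by_contra hne
    obtain ⟨a, ha, ha'⟩ := exists_bump (isOpen_compl_singleton (x := y')) hne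
    have h1 : a y = a y' := DFunLike.congr_fun h a
    rw [ha, ha' y' (by simp)] at h1
    exact one_ne_zero h1
  · obtain ⟨y, hy⟩ := exists_ker_le χ
    obtain ⟨u, hu⟩ : ∃ u, χ u ≠ 0 := by
      by_contra! h
      exact χ.2.1 (DFunLike.ext _ _ h)
    have hb : χ ((χ u)⁻¹ • u) = 1 := by rw [map_smul, smul_eq_mul, inv_mul_cancel₀ hu]
    generalize (χ u)⁻¹ • u = b at hb
    have hab : ∀ a : C₀(Y, ℂ), a y = χ a * b y := fun a => by
      have := hy (a - χ a • b) (by rw [map_sub, map_smul, hb, smul_eq_mul, mul_one, sub_self])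
      exact sub_eq_zero.1 this
    have hby : b y ≠ 0 := fun h0 => by
      obtain ⟨a, ha, -⟩ := exists_bump isOpen_univ (mem_univ y)
      rw [hab, h0, mul_zero] at ha
      exact zero_ne_one ha
    have hby1 : b y = 1 := by
      have h2 := hab (b * b)
      rw [map_mul, hb, one_mul, one_mul, ZeroAtInftyContinuousMap.mul_apply] at h2
      exact mul_left_cancel₀ hby (h2.trans (mul_one _).symm)
    refine ⟨y, DFunLike.ext _ _ fun a => ?_⟩
    rw [evalCharacter_apply, hab, hby1, mul_one]

/-- The canonical identification of `Y` with the spectrum of `C₀(Y)`. -/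
def evalEquiv : Y ≃ WeakDual.characterSpace ℂ C₀(Y, ℂ) :=
  Equiv.ofBijective evalCharacter evalCharacter_bijective

/-- For a proper morphism `ψ : C₀(Y) → C`, the map `ψ_*` from the spectrum of `C` to `Y`: the map
`χ ↦ χ ∘ ψ`, with the spectrum of `C₀(Y)` identified with `Y`. -/
def dualMap {C : Type*} [NonUnitalCStarAlgebra C] (ψ : C₀(Y, ℂ) →⋆ₙₐ[ℂ] C)
    (hψ : IsProperMorphism ψ) : WeakDual.characterSpace ℂ C → Y :=
  evalEquiv.symm ∘ spectrumMap ψ hψ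

theorem apply_dualMap {C : Type*} [NonUnitalCStarAlgebra C] (ψ : C₀(Y, ℂ) →⋆ₙₐ[ℂ] C)
    (hψ : IsProperMorphism ψ) (χ : WeakDual.characterSpace ℂ C) (a : C₀(Y, ℂ)) :
    a (dualMap ψ hψ χ) = χ (ψ a) := by
  rw [← spectrumMap_apply ψ hψ, ← evalCharacter_apply]
  exact DFunLike.congr_fun (evalEquiv.apply_symm_apply (spectrumMap ψ hψ χ)) a

end Spectrum

end FibrewiseCompactification

end

/-! Write `i` for the inclusion of `X` in `Z`. Both directions rest on
`mem_range_of_mem_closure_of_mem_pr`: no boundary point of `i(X)` lies over `pr f`.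

From `Z` to algebras, `C₀(X)` is the ideal of functions vanishing off `i(X)`, and its annihilator
consists of functions vanishing on the closure of `i(X)`. For such a `c`, the restriction to the
closed set `Z \ i(X)` vanishes off `g⁻¹(pr f)` and factors through `g`. A Tietze argument for proper
maps (`exists_extension_of_eq_zero`) then gives `a ∈ C₀(Y)` with `a ∘ g = c` off `i(X)` and `a = 0`
off `pr f`; the latter forces `a ∘ f ∈ C₀(X)`.

From `C` to spaces, commutators annihilate any commutative `*`-ideal. They therefore lie in `B^⊥`,
which is itself commutative because modulo `B` it comes from `C₀(Y)`; so they vanish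
(`mul_comm_of_exists`). Now `X` is the open set of characters nonzero on `B`. A bump in `C`
supported off its closure lies in `B^⊥`, hence equals some `ψ(a)` modulo `B`. These functions `a` on
`Y` (`exists_bump_dualMap`) separate points, detect neighbourhoods, and witness membership in `pr
f`. -/

noncomputable section

namespace FibrewiseCompactification

/-! ### Functions vanishing at infinity, pullbacks and extension by zero -/

section ZeroAtInfty

variable {X Y Z : Type*} [TopologicalSpace X] [TopologicalSpace Y] [TopologicalSpace Z]

theorem isCompact_setOf_le_norm (a : C₀(Y, ℂ)) {ε : ℝ} (hε : 0 < ε) :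
    IsCompact {y | ε ≤ ‖a y‖} := by
  obtain ⟨K, hK, hKa⟩ := mem_cocompact.1 (a.zero_at_infty' (Metric.ball_mem_nhds (0 : ℂ) hε))
  refine hK.of_isClosed_subset (isClosed_le continuous_const a.continuous.norm) fun y hy => ?_
  by_contra hyK
  have : ‖a y‖ < ε := by simpa using hKa hyK
  exact absurd hy (not_le.2 this)

theorem tendsto_cocompact_zero {a : Y → ℂ} (h : ∀ ε > 0, IsCompact {y | ε ≤ ‖a y‖}) :
    Tendsto a (cocompact Y) (𝓝 0) := by
  refine Metric.tendsto_nhds.2 fun ε hε => mem_cocompact.2 ⟨_, h ε hε, fun y hy => ?_⟩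
  simpa using hy

theorem dist_le_of_forall {b c : C₀(X, ℂ)} {ε : ℝ} (hε : 0 ≤ ε) (h : ∀ x, ‖b x - c x‖ ≤ ε) :
    dist b c ≤ ε := by
  rw [← ZeroAtInftyContinuousMap.dist_toBCF_eq_dist, BoundedContinuousFunction.dist_le hε]
  exact fun x => (dist_eq_norm (b x) (c x)).trans_le (h x)

theorem exists_bump_of_isCompact [T2Space Y] [LocallyCompactSpace Y] {K : Set Y}
    (hK : IsCompact K) : ∃ a : C₀(Y, ℂ), (∀ y ∈ K, a y = 1) ∧ ∀ y, ‖a y - 1‖ ≤ 1 := by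
  obtain ⟨p, hp1, -, hpc, hp01⟩ := exists_continuous_one_zero_of_isCompact hK
    (isClosed_empty (X := Y)) (disjoint_empty K)
  have hc : HasCompactSupport fun y => (p y : ℂ) :=
    hpc.comp_left (g := fun r : ℝ => (r : ℂ)) Complex.ofReal_zero
  refine ⟨⟨⟨fun y => (p y : ℂ), by fun_prop⟩, hc.is_zero_at_infty⟩, fun y hy => ?_, fun y => ?_⟩
  · change (p y : ℂ) = 1
    rw [hp1 hy]
    simp
  · change ‖(p y : ℂ) - 1‖ ≤ 1
    rw [← Complex.ofReal_one, ← Complex.ofReal_sub, Complex.norm_real, Real.norm_eq_abs, abs_le]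
    constructor <;> linarith [(hp01 y).1, (hp01 y).2]

/-- Take `a = 1` on the compact image of `{ε ≤ ‖c‖}`; elsewhere `‖a - 1‖ ≤ 1` and `‖c‖ < ε`. This is
what makes pullbacks nondegenerate, without properness of `f`. -/
theorem exists_approx_unit_comp [T2Space Y] [LocallyCompactSpace Y] {f : X → Y}
    (hf : Continuous f) (c : C₀(X, ℂ)) {ε : ℝ} (hε : 0 < ε) :
    ∃ a : C₀(Y, ℂ), ∀ x, ‖a (f x) * c x - c x‖ ≤ ε := by
  obtain ⟨a, ha1, ha⟩ := exists_bump_of_isCompact ((isCompact_setOf_le_norm c hε).image hf)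
  refine ⟨a, fun x => ?_⟩
  rw [← sub_one_mul, norm_mul]
  by_cases hx : ε ≤ ‖c x‖
  · rw [ha1 _ ⟨x, hx, rfl⟩]
    simpa using hε.le
  · nlinarith [ha (f x), norm_nonneg (c x), norm_nonneg (a (f x) - 1)]

theorem isMorphism_of_apply [T2Space Y] [LocallyCompactSpace Y] {f : X → Y} (hf : Continuous f)
    {φ : C₀(Y, ℂ) →⋆ₙₐ[ℂ] 𝓜(ℂ, C₀(X, ℂ))} (hφ : ∀ a b x, (φ a).fst b x = a (f x) * b x) :
    IsMorphism φ := fun c => by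
  refine Metric.mem_closure_iff.2 fun ε hε => ?_
  obtain ⟨a, ha⟩ := exists_approx_unit_comp hf c (half_pos hε)
  refine ⟨(φ a).fst c, Submodule.subset_span ⟨a, c, rfl⟩, ?_⟩
  rw [dist_comm]
  exact (dist_le_of_forall (half_pos hε).le fun x => by rw [hφ]; exact ha x).trans_lt
    (half_lt_self hε)

theorem isMorphism_pullback [T2Space Y] [LocallyCompactSpace Y] (f : C(X, Y)) :
    IsMorphism (pullback f) :=
  isMorphism_of_apply f.continuous fun _ _ _ => rfl

theorem isProperMorphism_properPullback [T2Space Y] [LocallyCompactSpace Y] {g : Z → Y}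
    (hg : IsProperMap g) : IsProperMorphism (properPullback g hg) :=
  isMorphism_of_apply hg.continuous fun _ _ _ => rfl

theorem injective_properPullback {g : Z → Y} (hg : IsProperMap g) (hs : Function.Surjective g) :
    Function.Injective (properPullback g hg) := fun a b h => by
  ext y
  obtain ⟨z, rfl⟩ := hs y
  exact DFunLike.congr_fun h z

theorem mem_pimsnerIdeal_pullback {f : C(X, Y)} {a : C₀(Y, ℂ)} {b : C₀(X, ℂ)}
    (h : ∀ x, b x = a (f x)) : a ∈ pimsnerIdeal (pullback f) := by
  refine ⟨b, ?_⟩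
  ext c x
  · exact congrArg (· * c x) (h x)
  · exact (mul_comm _ _).trans (congrArg (· * c x) (h x))

theorem exists_of_mem_pimsnerIdeal_pullback [T2Space X] [LocallyCompactSpace X] {f : C(X, Y)}
    {a : C₀(Y, ℂ)} (h : a ∈ pimsnerIdeal (pullback f)) : ∃ b : C₀(X, ℂ), ∀ x, b x = a (f x) := by
  obtain ⟨b, hb⟩ := h
  refine ⟨b, fun x => ?_⟩
  obtain ⟨c, hc, -⟩ := exists_bump isOpen_univ (mem_univ x)
  have h1 : ((DoubleCentralizer.coeHom (𝕜 := ℂ) (A := C₀(X, ℂ)) b).fst c) x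
    = ((pullback f a).fst c) x := by rw [hb]
  change b x * c x = a (f x) * c x at h1
  simpa [hc] using h1

/-- Extension by zero along an open embedding, as a map `C₀(X) → C₀(Z)`. -/
def extendZero [T2Space Z] {i : X → Z} (hi : IsOpenEmbedding i) : C₀(X, ℂ) →⋆ₙₐ[ℂ] C₀(Z, ℂ) where
  toFun b :=
    -- The superlevel sets are images of those of `b`. Compactness gives vanishing at infinity;
    -- closedness in the Hausdorff space `Z` gives continuity off the image of `i`.
    have key : ∀ ε > 0, IsCompact {z | ε ≤ ‖Function.extend i b 0 z‖} := fun ε hε => by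
      convert (isCompact_setOf_le_norm b hε).image hi.continuous using 1
      ext z
      by_cases hz : ∃ x, i x = z
      · obtain ⟨x, rfl⟩ := hz
        simp [hi.injective.extend_apply, hi.injective.eq_iff]
      · simp only [mem_ofPred_eq, Function.extend_apply' _ _ _ hz, mem_image]
        refine iff_of_false (by simpa using hε) fun ⟨x, _, hx⟩ => hz ⟨x, hx⟩
    { toFun := Function.extend i b 0
      continuous_toFun := continuous_iff_continuousAt.2 fun z => by
        by_cases hz : ∃ x, i x = z
        · obtain ⟨x, rfl⟩ := hz
          rw [← hi.continuousAt_iff, Function.extend_comp hi.injective]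
          exact b.continuous.continuousAt
        · have h0 : Function.extend i b 0 z = 0 := Function.extend_apply' _ _ _ hz
          refine Metric.tendsto_nhds.2 fun ε hε => ?_
          rw [h0]
          filter_upwards [(key ε hε).isClosed.isOpen_compl.mem_nhds
            (show z ∉ {z | ε ≤ ‖Function.extend i b 0 z‖} by simpa [h0] using hε)] with w hw
          simpa using hw
      zero_at_infty' := tendsto_cocompact_zero key }
  map_smul' r b := by
    ext z
    by_cases hz : ∃ x, i x = z
    · obtain ⟨x, rfl⟩ := hz
      simp [hi.injective.extend_apply]
    · simp [Function.extend_apply' _ _ _ hz]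
  map_zero' := by
    ext z
    by_cases hz : ∃ x, i x = z
    · obtain ⟨x, rfl⟩ := hz
      simp [hi.injective.extend_apply]
    · simp [Function.extend_apply' _ _ _ hz]
  map_add' b c := by
    ext z
    by_cases hz : ∃ x, i x = z
    · obtain ⟨x, rfl⟩ := hz
      simp [hi.injective.extend_apply]
    · simp [Function.extend_apply' _ _ _ hz]
  map_mul' b c := by
    ext z
    by_cases hz : ∃ x, i x = z
    · obtain ⟨x, rfl⟩ := hz
      simp [hi.injective.extend_apply]
    · simp [Function.extend_apply' _ _ _ hz]
  map_star' b := by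
    ext z
    by_cases hz : ∃ x, i x = z
    · obtain ⟨x, rfl⟩ := hz
      simp [hi.injective.extend_apply]
    · simp [Function.extend_apply' _ _ _ hz]

variable [T2Space Z] {i : X → Z} (hi : IsOpenEmbedding i)

theorem extendZero_apply (b : C₀(X, ℂ)) (x : X) : extendZero hi b (i x) = b x :=
  hi.injective.extend_apply _ _ _

theorem extendZero_apply_of_notMem (b : C₀(X, ℂ)) {z : Z} (hz : z ∉ range i) :
    extendZero hi b z = 0 :=
  Function.extend_apply' _ _ _ hz

theorem mem_range_extendZero {c : C₀(Z, ℂ)} :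
    c ∈ range (extendZero hi) ↔ ∀ z ∉ range i, c z = 0 := by
  refine ⟨?_, fun h => ?_⟩
  · rintro ⟨b, rfl⟩ z hz
    exact extendZero_apply_of_notMem hi b hz
  · refine ⟨⟨⟨c ∘ i, c.continuous.comp hi.continuous⟩, tendsto_cocompact_zero fun ε hε =>
      hi.isInducing.isCompact_preimage' (isCompact_setOf_le_norm c hε) fun z hz => ?_⟩, ?_⟩
    · by_contra hzi
      rw [mem_ofPred_eq, h z hzi, norm_zero] at hz
      exact absurd hz (not_le.2 hε)
    · ext z
      by_cases hz : z ∈ range i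
      · obtain ⟨x, rfl⟩ := hz
        exact extendZero_apply hi _ x
      · rw [extendZero_apply_of_notMem hi _ hz, h z hz]

theorem isIdealInclusion_extendZero [LocallyCompactSpace Z] : IsIdealInclusion (extendZero hi) where
  injective b c h := by
    ext x
    rw [← extendZero_apply hi, h, extendZero_apply]
  isClosed_range := by
    -- The range is an intersection of kernels of evaluations, hence closed.
    have : range (extendZero hi) = ⋂ z ∈ (range i)ᶜ, {c | evalCharacter z c = 0} := by
      ext c
      simp only [mem_iInter, mem_compl_iff, mem_ofPred_eq, evalCharacter_apply]
      exact mem_range_extendZero hi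
    rw [this]
    exact isClosed_biInter fun z _ => isClosed_eq (map_continuous (evalCharacter z))
      continuous_const
  mul_left_mem c b := (mem_range_extendZero hi).2 fun z hz => by
    rw [ZeroAtInftyContinuousMap.mul_apply, extendZero_apply_of_notMem hi b hz, mul_zero]
  mul_right_mem c b := (mem_range_extendZero hi).2 fun z hz => by
    rw [ZeroAtInftyContinuousMap.mul_apply, extendZero_apply_of_notMem hi b hz, zero_mul]

theorem inducedMorphism_comp_properPullback [LocallyCompactSpace Z] {g : Z → Y}
    (hg : IsProperMap g) (f : C(X, Y)) (hf : g ∘ i = f) :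
    (isIdealInclusion_extendZero hi).inducedMorphism.comp (properPullback g hg) = pullback f := by
  have h := isIdealInclusion_extendZero hi
  have hfi : ∀ x, g (i x) = f x := congrFun hf
  ext a b x
  · change h.leftMul (properPullback g hg a) b x = a (f x) * b x
    rw [← extendZero_apply hi, h.map_leftMul, ZeroAtInftyContinuousMap.mul_apply,
      extendZero_apply, ← hfi]
    rfl
  · change h.rightMul (properPullback g hg a) b x = a (f x) * b x
    rw [← extendZero_apply hi, h.map_rightMul, ZeroAtInftyContinuousMap.mul_apply,
      extendZero_apply, ← hfi, mul_comm]
    rfl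

end ZeroAtInfty

/-! ### Tietze extension along proper maps -/

section Extension

/-- `G` is a closed map, hence a quotient map onto its closed image. So `c` descends to the image,
and Tietze extends it to `Q`. -/
theorem exists_comp_eq_of_isCompact {K Q : Type*} [TopologicalSpace K] [CompactSpace K]
    [TopologicalSpace Q] [CompactSpace Q] [T2Space Q] (G : C(K, Q)) (c : C(K, ℂ))
    (h : Function.FactorsThrough c G) : ∃ a : C(Q, ℂ), ∀ k, a (G k) = c k := by
  have hq : IsQuotientMap (rangeFactorization G) :=
    (G.continuous.rangeFactorization.isClosedMap).isQuotientMap G.continuous.rangeFactorization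
      rangeFactorization_surjective
  have hq' : IsQuotientMap (⟨_, G.continuous.rangeFactorization⟩ : C(K, range G)) := hq
  obtain ⟨a, ha⟩ := ContinuousMap.exists_restrict_eq
    (isCompact_range G.continuous).isClosed
    (hq'.lift c fun k k' hk => h (congrArg Subtype.val hk))
  refine ⟨a, fun k => ?_⟩
  have h1 := DFunLike.congr_fun ha (rangeFactorization G k)
  have h2 := DFunLike.congr_fun (hq'.lift_comp c fun k k' hk => h (congrArg Subtype.val hk)) k
  exact h1.trans h2

variable {E Y : Type*} [TopologicalSpace E] [T2Space E] [TopologicalSpace Y] [T2Space Y]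
  [LocallyCompactSpace Y]

/-- A form of the Tietze extension theorem for functions vanishing at infinity. -/
theorem exists_comp_eq {g : E → Y} (hg : IsProperMap g) (c : C₀(E, ℂ))
    (h : Function.FactorsThrough c g) : ∃ a : C₀(Y, ℂ), ∀ e, a (g e) = c e := by
  have hgt : Tendsto g (cocompact E) (cocompact Y) :=
    (hasBasis_cocompact.tendsto_right_iff).2 fun _ hK =>
      (hg.isCompact_preimage hK).compl_mem_cocompact
  -- Properness lets `g` extend to the one-point compactifications. Sending infinity to `0` in `c'`
  -- forces the extension `a` to vanish at infinity.
  let G : C(OnePoint E, OnePoint Y) := OnePoint.continuousMapMk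
    ⟨fun e => (g e : OnePoint Y), OnePoint.continuous_coe.comp hg.continuous⟩ OnePoint.infty <| by
      have := (OnePoint.tendsto_coe_infty (X := Y))
      rw [coclosedCompact_eq_cocompact] at this ⊢
      exact this.comp hgt
  let c' : C(OnePoint E, ℂ) := OnePoint.continuousMapMk ⟨c, c.continuous⟩ 0 <| by
    rw [coclosedCompact_eq_cocompact]
    exact c.zero_at_infty'
  obtain ⟨a, ha⟩ := exists_comp_eq_of_isCompact G c' fun k k' hk => by
    induction k using OnePoint.rec <;> induction k' using OnePoint.rec
    · rfl
    · exact absurd hk.symm (OnePoint.coe_ne_infty _)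
    · exact absurd hk (OnePoint.coe_ne_infty _)
    · exact h (OnePoint.coe_injective hk)
  have ha0 : a OnePoint.infty = 0 := ha OnePoint.infty
  refine ⟨⟨⟨fun y => a y, a.continuous.comp OnePoint.continuous_coe⟩, ?_⟩, fun e => ha e⟩
  have := OnePoint.tendsto_coe_infty (X := Y)
  rw [coclosedCompact_eq_cocompact] at this
  rw [← ha0]
  exact (a.continuous.tendsto _).comp this

end Extension

/-! ### The set `pr f` -/

section Pr

variable {X Y Z : Type*} [TopologicalSpace X] [TopologicalSpace Y] [TopologicalSpace Z]

theorem isOpen_pr (f : X → Y) : IsOpen (pr f) := isOpen_sUnion fun _ hW => hW.1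

/-- Over `W` as in the definition of `pr f`, the range of `i` lies in `i(f⁻¹(closure W))`. That set
is compact, hence closed, so no new limit points appear over `W`. -/
theorem mem_range_of_mem_closure_of_mem_pr [T2Space Z] {f : X → Y} {g : Z → Y} {i : X → Z}
    (hi : Continuous i) (hg : Continuous g) (hf : g ∘ i = f) {z : Z} (hz : z ∈ closure (range i))
    (hgz : g z ∈ pr f) : z ∈ range i := by
  obtain ⟨W, ⟨hWo, -, hWc⟩, hzW⟩ := hgz
  have h1 : z ∈ closure (range i ∩ g ⁻¹' W) :=
    (hWo.preimage hg).closure_inter ⟨hz, hzW⟩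
  have h2 : range i ∩ g ⁻¹' W ⊆ i '' (f ⁻¹' closure W) := by
    rintro _ ⟨⟨x, rfl⟩, hx⟩
    refine ⟨x, subset_closure ?_, rfl⟩
    rw [← hf]
    exact hx
  exact image_subset_range _ _ (closure_minimal h2 (hWc.image hi).isClosed h1)

/-- Containment in a compact set passes to subsets and finite unions, so compact induction reduces
to a single `W`. -/
theorem exists_isCompact_preimage_subset {f : X → Y} {K : Set Y} (hK : IsCompact K)
    (hKf : K ⊆ pr f) : ∃ L, IsCompact L ∧ f ⁻¹' K ⊆ L := by
  refine hK.induction_on (p := fun s => ∃ L, IsCompact L ∧ f ⁻¹' s ⊆ L)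
    ⟨∅, isCompact_empty, subset_rfl⟩ (fun s t hst ⟨L, hL, h⟩ => ⟨L, hL, (preimage_mono hst).trans h⟩)
    (fun s t ⟨L, hL, h⟩ ⟨L', hL', h'⟩ => ⟨L ∪ L', hL.union hL', union_subset_union h h'⟩)
    fun y hy => ?_
  obtain ⟨W, ⟨hWo, -, hWc⟩, hyW⟩ := hKf hy
  exact ⟨W, mem_nhdsWithin_of_mem_nhds (hWo.mem_nhds hyW), _, hWc, preimage_mono subset_closure⟩

theorem isCompact_setOf_le_norm_comp {f : X → Y} (hf : Continuous f) {a : C₀(Y, ℂ)}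
    (ha : ∀ y ∉ pr f, a y = 0) {ε : ℝ} (hε : 0 < ε) : IsCompact {x | ε ≤ ‖a (f x)‖} := by
  obtain ⟨L, hL, h⟩ := exists_isCompact_preimage_subset (f := f) (isCompact_setOf_le_norm a hε)
    fun y hy => by
      by_contra hyf
      rw [mem_ofPred_eq, ha y hyf, norm_zero] at hy
      exact absurd hy (not_le.2 hε)
  exact hL.of_isClosed_subset (isClosed_le continuous_const (a.continuous.comp hf).norm) h

end Pr

/-! ### From spaces to algebras -/

section FunctionAlgebras

variable {X Y Z : Type*} [TopologicalSpace X] [TopologicalSpace Y] [T2Space Y]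
  [LocallyCompactSpace Y] [TopologicalSpace Z] [T2Space Z]

/-- Both prescriptions, `c` on `E` and `0` on `S`, form one function on the disjoint union `E ⊕ S`.
This maps properly to `Y`, so `exists_comp_eq` applies. -/
theorem exists_extension_of_eq_zero {g : Z → Y} (hg : IsProperMap g) {E : Set Z} (hE : IsClosed E)
    {S : Set Y} (hS : IsClosed S) (c : C₀(Z, ℂ)) (hcS : ∀ z ∈ E, g z ∈ S → c z = 0)
    (hc : ∀ z ∈ E, ∀ w ∈ E, g z = g w → c z = c w) :
    ∃ a : C₀(Y, ℂ), (∀ z ∈ E, a (g z) = c z) ∧ ∀ y ∈ S, a y = 0 := by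
  let G : E ⊕ S → Y := Sum.elim (fun z => g z) (↑)
  have hG : IsProperMap G := by
    refine isProperMap_iff_isCompact_preimage.2
      ⟨(hg.continuous.comp continuous_subtype_val).sumElim continuous_subtype_val, fun K hK => ?_⟩
    have : G ⁻¹' K = Sum.inl '' ((↑) ⁻¹' (g ⁻¹' K) : Set E) ∪ Sum.inr '' ((↑) ⁻¹' K : Set S) := by
      ext (z | y) <;> simp [G]
    rw [this]
    exact ((hE.isClosedEmbedding_subtypeVal.isCompact_preimage (hg.isCompact_preimage hK)).image
      continuous_inl).union
      ((hS.isClosedEmbedding_subtypeVal.isCompact_preimage hK).image continuous_inr)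
  let c' : C₀(E ⊕ S, ℂ) := ⟨⟨Sum.elim (fun z => c z) 0,
      (c.continuous.comp continuous_subtype_val).sumElim continuous_const⟩,
    tendsto_cocompact_zero fun ε hε => by
      convert (hE.isClosedEmbedding_subtypeVal.isCompact_preimage
        (isCompact_setOf_le_norm c hε)).image (continuous_inl (Y := S)) using 1
      ext (z | y) <;> simp [hε]⟩
  obtain ⟨a, ha⟩ := exists_comp_eq hG c' <| by
    rintro (z | y) (w | y') h
    · exact hc z z.2 w w.2 h
    · exact hcS z z.2 (by rw [show g z = y' from h]; exact y'.2)
    · exact (hcS w w.2 (by rw [show g w = y from h.symm]; exact y.2)).symm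
    · rfl
  exact ⟨a, fun z hz => ha (Sum.inl ⟨z, hz⟩), fun y hy => ha (Sum.inr ⟨y, hy⟩)⟩

theorem eq_zero_of_mem_annihilator_extendZero [T2Space X] [LocallyCompactSpace X] {i : X → Z}
    (hi : IsOpenEmbedding i)
    {c : C₀(Z, ℂ)} (hc : c ∈ annihilator (range (extendZero hi))) {z : Z}
    (hz : z ∈ closure (range i)) : c z = 0 := by
  have hcl : IsClosed {z | c z = 0} := isClosed_eq c.continuous continuous_const
  refine closure_minimal ?_ hcl hz
  rintro _ ⟨x, rfl⟩
  obtain ⟨b, hb, -⟩ := exists_bump isOpen_univ (mem_univ x)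
  have h := DFunLike.congr_fun (hc _ ⟨b, rfl⟩) (i x)
  rw [ZeroAtInftyContinuousMap.mul_apply, extendZero_apply, hb, mul_one] at h
  exact h

theorem IsFibrewiseCompactification.isNCFibrewiseCompactification [T2Space X]
    [LocallyCompactSpace X] {f : C(X, Y)} {g : Z → Y} (hg : IsFibrewiseCompactification f g) :
    IsNCFibrewiseCompactification (pullback f) (properPullback g hg.isProperMap) := by
  have := hg.locallyCompactSpace
  have hgp := hg.isProperMap
  refine ⟨isProperMorphism_properPullback hgp, ?_⟩
  obtain ⟨i, hi, hf, hemb, hpr, -⟩ := hg.exists_openInclusion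
  refine ⟨extendZero hi, isIdealInclusion_extendZero hi,
    inducedMorphism_comp_properPullback hi hgp f hf, fun c hc => ?_⟩
  have h0 : ∀ z ∈ (range i)ᶜ, g z ∈ (pr f)ᶜ → c z = 0 := fun z _ hgz =>
    eq_zero_of_mem_annihilator_extendZero hi hc (by_contra fun h => hgz (hpr ⟨z, h, rfl⟩))
  have h1 : ∀ z ∈ (range i)ᶜ, z ∈ closure (range i) → g z ∉ pr f := fun z hz hzc hgz =>
    hz (mem_range_of_mem_closure_of_mem_pr hi.continuous hgp.continuous hf hzc hgz)
  -- Take `E = Z \ i(X)` and `S = Y \ pr f`. Over `pr f`, points of `E` avoid the closure of `i(X)`,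
  -- where `g` is injective; over `S`, `c` vanishes on `E`.
  obtain ⟨a, ha, haS⟩ := exists_extension_of_eq_zero hgp hi.isOpen_range.isClosed_compl
    (isOpen_pr f).isClosed_compl c h0 fun z hz w hw hzw => by
      by_cases hgz : g z ∈ pr f
      · have hz' : z ∉ closure (range i) := fun h => h1 z hz h hgz
        have hw' : w ∉ closure (range i) := fun h => h1 w hw h (hzw ▸ hgz)
        have := @hemb.injective ⟨z, hz'⟩ ⟨w, hw'⟩ hzw
        rw [show z = w from congrArg Subtype.val this]
      · rw [h0 z hz hgz, h0 w hw (hzw ▸ hgz)]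
  refine ⟨a, mem_pimsnerIdeal_pullback (b := ⟨⟨fun x => a (f x), a.continuous.comp f.continuous⟩,
    tendsto_cocompact_zero fun ε hε => isCompact_setOf_le_norm_comp f.continuous haS hε⟩)
    fun _ => rfl, (mem_range_extendZero hi).2 fun z hz => ?_⟩
  rw [ZeroAtInftyContinuousMap.sub_apply, sub_eq_zero]
  exact ha z hz

end FunctionAlgebras

/-! ### Commutativity of `C` -/

section Commutativity

variable {A B C : Type*} [NonUnitalCStarAlgebra A] [NonUnitalCStarAlgebra B]
  [NonUnitalCStarAlgebra C]

/-- Commutators annihilate every commutative two-sided `*`-ideal. -/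
theorem commutator_mul_eq_zero {J : Set C} (hl : ∀ (c : C), ∀ i ∈ J, c * i ∈ J)
    (hr : ∀ (c : C), ∀ i ∈ J, i * c ∈ J) (hs : ∀ i ∈ J, star i ∈ J)
    (hJ : ∀ i ∈ J, ∀ k ∈ J, i * k = k * i) (c d : C) {i : C} (hi : i ∈ J) :
    (c * d - d * c) * i = 0 := by
  have key : ∀ i ∈ J, ∀ k ∈ J, (c * d - d * c) * (i * k) = 0 := fun i hi k hk => by
    rw [sub_mul, sub_eq_zero]
    calc c * d * (i * k) = c * (d * i * k) := by simp only [mul_assoc]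
      _ = c * k * (d * i) := by rw [hJ _ (hl d i hi) _ hk, mul_assoc]
      _ = d * (i * (c * k)) := by rw [hJ _ (hl c k hk) _ (hl d i hi), mul_assoc]
      _ = d * c * (k * i) := by rw [hJ _ hi _ (hl c k hk)]; simp only [mul_assoc]
      _ = d * c * (i * k) := by rw [hJ _ hi _ hk]
  -- With `x` the commutator, `(x i)(x i)* = x (i (i* x*))`, and `i* x*` is again in `J`; this
  -- reduces the claim to products of two elements of `J`.
  rw [← CStarRing.mul_star_self_eq_zero_iff, star_mul, mul_assoc]
  exact key i hi _ (hr _ _ (hs i hi))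

theorem mul_comm_of_exists {φ : A →⋆ₙₐ[ℂ] 𝓜(ℂ, B)} {ψ : A →⋆ₙₐ[ℂ] C} {j : B →⋆ₙₐ[ℂ] C}
    (h : IsIdealInclusion j) (hA : ∀ a a' : A, a * a' = a' * a)
    (hB : ∀ b b' : B, b * b' = b' * b)
    (hc : ∀ c ∈ annihilator (range j), ∃ a ∈ pimsnerIdeal φ, ψ a - c ∈ range j) (c d : C) :
    c * d = d * c := by
  have hsR : ∀ i ∈ range j, star i ∈ range j := by
    rintro _ ⟨b, rfl⟩
    exact ⟨star b, map_star j b⟩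
  have hlR : ∀ (c : C), ∀ i ∈ range j, c * i ∈ range j := by
    rintro c _ ⟨b, rfl⟩
    exact h.mul_left_mem c b
  have hrR : ∀ (c : C), ∀ i ∈ range j, i * c ∈ range j := by
    rintro c _ ⟨b, rfl⟩
    exact h.mul_right_mem c b
  have hlI : ∀ (c : C), ∀ i ∈ annihilator (range j), c * i ∈ annihilator (range j) :=
    fun c i hi b hb => by rw [mul_assoc, hi b hb, mul_zero]
  have hrI : ∀ (c : C), ∀ i ∈ annihilator (range j), i * c ∈ annihilator (range j) :=
    fun c i hi b hb => by rw [mul_assoc, hi _ (hlR c b hb)]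
  have hsI : ∀ i ∈ annihilator (range j), star i ∈ annihilator (range j) := fun i hi b hb => by
    rw [← CStarRing.star_mul_self_eq_zero_iff, star_mul, star_star, mul_assoc,
      hi _ (hlR _ b hb), mul_zero]
  have h0 : ∀ i ∈ range j, i ∈ annihilator (range j) → i = 0 := fun i hi hi' => by
    rw [← CStarRing.mul_star_self_eq_zero_iff]
    exact hi' _ (hsR i hi)
  have hcomm : ∀ c d : C, c * d - d * c ∈ annihilator (range j) := fun c d i hi =>
    commutator_mul_eq_zero hlR hrR hsR (by
      rintro _ ⟨b, rfl⟩ _ ⟨b', rfl⟩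
      rw [← map_mul, hB, map_mul]) c d hi
  have hI : ∀ c ∈ annihilator (range j), ∀ d ∈ annihilator (range j), c * d = d * c := by
    intro c hcI d hdI
    obtain ⟨a, -, b, hb⟩ := hc c hcI
    obtain ⟨a', -, b', hb'⟩ := hc d hdI
    -- The commutator is already in `B^⊥`, which meets `B` only in `0`. It is also in `B`, since
    -- modulo `B` the factors are the commuting `ψ a` and `ψ a'`.
    refine sub_eq_zero.1 (h0 _ ?_ (hcomm c d))
    obtain ⟨u, hu⟩ := h.mul_left_mem (ψ a) b'
    obtain ⟨u', hu'⟩ := h.mul_right_mem (ψ a') b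
    obtain ⟨v, hv⟩ := h.mul_left_mem (ψ a') b
    obtain ⟨v', hv'⟩ := h.mul_right_mem (ψ a) b'
    refine ⟨v + v' - b' * b - (u + u' - b * b'), ?_⟩
    have e1 : c = ψ a - j b := by rw [hb]; abel
    have e2 : d = ψ a' - j b' := by rw [hb']; abel
    have e3 : ψ a * ψ a' = ψ a' * ψ a := by rw [← map_mul, hA, map_mul]
    simp only [map_sub, map_add, map_mul, hu, hu', hv, hv', e1, e2, sub_mul, mul_sub, e3]
    abel
  -- Applied to `J = B^⊥`, with the adjoint of the commutator as the element of `J`, this gives `x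
  -- x* = 0`.
  have hx := commutator_mul_eq_zero hlI hrI hsI hI c d (hsI _ (hcomm c d))
  exact sub_eq_zero.1 ((CStarRing.mul_star_self_eq_zero_iff _).1 hx)

end Commutativity

/-! ### Gelfand theory through the unitization -/

section Gelfand

open WeakDual Unitization

variable {C : Type*}

/-- The extension of a character to the unitization. -/
def extendCharacter [NonUnitalCommCStarAlgebra C] (χ : characterSpace ℂ C) :
    characterSpace ℂ (Unitization ℂ C) :=
  CharacterSpace.equivAlgHom.symm (Unitization.lift (CharacterSpace.toNonUnitalAlgHom χ))

theorem extendCharacter_inr [NonUnitalCommCStarAlgebra C] (χ : characterSpace ℂ C) (c : C) :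
    extendCharacter χ (inr c) = χ c := by
  change Unitization.lift (CharacterSpace.toNonUnitalAlgHom χ) (inr c) = χ c
  simp

/-- The character `(r, c) ↦ r` of the unitization. -/
def fstCharacter [NonUnitalCommCStarAlgebra C] : characterSpace ℂ (Unitization ℂ C) :=
  CharacterSpace.equivAlgHom.symm (Unitization.fstHom ℂ C)

/-- Restriction of characters of the unitization, as functionals. -/
def restrictCharacter [NonUnitalCommCStarAlgebra C] (χ : characterSpace ℂ (Unitization ℂ C)) :
    WeakDual ℂ C :=
  StrongDual.toWeakDual ((CharacterSpace.toCLM χ).comp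
    ⟨Unitization.inrHom ℂ ℂ C, Unitization.continuous_inr⟩)

theorem continuous_restrictCharacter [NonUnitalCommCStarAlgebra C] :
    Continuous (restrictCharacter (C := C)) :=
  WeakDual.continuous_of_continuous_eval fun c =>
    (WeakDual.eval_continuous (inr c : Unitization ℂ C)).comp continuous_subtype_val

theorem restrictCharacter_extendCharacter [NonUnitalCommCStarAlgebra C]
    (χ : characterSpace ℂ C) : restrictCharacter (extendCharacter χ) = χ :=
  DFunLike.ext _ _ fun c => extendCharacter_inr χ c

/-- A character of the unitization restricts to `C` either as zero or as a character, so the Gelfand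
transform of `c` vanishes. -/
theorem eq_zero_of_forall_character [NonUnitalCommCStarAlgebra C] {c : C}
    (h : ∀ χ : characterSpace ℂ C, χ c = 0) : c = 0 := by
  have h1 : gelfandTransform ℂ (Unitization ℂ C) (inr c) = 0 := by
    ext χ
    change χ (inr c) = 0
    by_cases hχ : restrictCharacter χ = 0
    · exact DFunLike.congr_fun hχ c
    · exact h ⟨restrictCharacter χ, hχ, fun x y => by
        change χ (inr (x * y)) = χ (inr x) * χ (inr y)
        rw [inr_mul, map_mul]⟩
  have h2 := (gelfandTransform_bijective (Unitization ℂ C)).1 (h1.trans (map_zero _).symm)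
  exact inr_injective h2

theorem exists_bump_character [NonUnitalCommCStarAlgebra C] {V : Set (characterSpace ℂ C)}
    (hV : IsOpen V) {χ₀ : characterSpace ℂ C} (hχ₀ : χ₀ ∈ V) :
    ∃ c : C, χ₀ c = 1 ∧ ∀ χ ∉ V, χ c = 0 := by
  obtain ⟨V', hV', rfl⟩ := isOpen_induced_iff.1 hV
  let W : Set (characterSpace ℂ (Unitization ℂ C)) := restrictCharacter ⁻¹' (V' ∩ {0}ᶜ)
  have hW : IsOpen W := (hV'.inter isOpen_compl_singleton).preimage continuous_restrictCharacter
  have hmem : ∀ χ : characterSpace ℂ C, extendCharacter χ ∈ W ↔ (χ : WeakDual ℂ C) ∈ V' :=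
    fun χ => by
      simp only [W, mem_preimage, restrictCharacter_extendCharacter]
      exact and_iff_left χ.2.1
  obtain ⟨F, hF1, hF0⟩ := exists_bump hW ((hmem χ₀).2 hχ₀)
  obtain ⟨u, hu⟩ := (gelfandTransform_bijective (Unitization ℂ C)).2 (F : C(_, ℂ))
  have huF : ∀ χ, χ u = F χ := fun χ => DFunLike.congr_fun hu χ
  -- `fstCharacter` restricts to `0` on `C` and so lies outside `W`; hence `u` has no scalar part
  -- and belongs to `C`.
  have hfst : u.fst = 0 := by
    refine (huF fstCharacter).trans (hF0 _ fun h => h.2 ?_)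
    exact DFunLike.ext _ _ fun c => Unitization.fst_inr ℂ c
  have hinr : u = inr u.snd := Unitization.ext hfst rfl
  refine ⟨u.snd, ?_, fun χ hχ => ?_⟩
  · rw [← extendCharacter_inr, ← hinr, huF, hF1]
  · rw [← extendCharacter_inr, ← hinr, huF, hF0 _ fun h => hχ ((hmem χ).1 h)]

end Gelfand

/-! ### Topology of the spectrum and properness of the dual map -/

section Spectrum

open WeakDual

variable {C : Type*} [NonUnitalCommCStarAlgebra C]

theorem norm_character_apply_le (χ : characterSpace ℂ C) (c : C) : ‖χ c‖ ≤ ‖c‖ := by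
  rw [← extendCharacter_inr, ← Unitization.norm_inr (𝕜 := ℂ) c]
  exact AlgHom.norm_apply_le_self (CharacterSpace.toAlgHom (extendCharacter χ)) _

/-- By Banach–Alaoglu: the characters together with `0` form a weak-* closed set, and the bound `ε ≤
‖χ c‖` excludes `0`. -/
theorem isCompact_setOf_le_norm_character (c : C) {ε : ℝ} (hε : 0 < ε) :
    IsCompact {χ : characterSpace ℂ C | ε ≤ ‖χ c‖} := by
  have hcl : IsClosed ((characterSpace ℂ C ∪ {0}) ∩ {φ : WeakDual ℂ C | ε ≤ ‖φ c‖}) :=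
    (CharacterSpace.union_zero_isClosed ℂ C).inter
      (isClosed_le continuous_const (WeakDual.eval_continuous c).norm)
  have hK := (WeakDual.isCompact_closedBall (𝕜 := ℂ) (E := C) 0 1).inter_right hcl
  have hmem : ∀ φ ∈ (characterSpace ℂ C ∪ {0}) ∩ {φ : WeakDual ℂ C | ε ≤ ‖φ c‖},
      φ ∈ characterSpace ℂ C := by
    rintro φ ⟨hφ | rfl, hφc⟩
    · exact hφ
    · have h0 : ε ≤ ‖(0 : ℂ)‖ := hφc
      rw [norm_zero] at h0
      exact absurd h0 (not_le.2 hε)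
  convert IsInducing.subtypeVal.isCompact_preimage' hK fun φ hφ => ⟨⟨φ, hmem φ hφ.2⟩, rfl⟩ using 1
  ext χ
  refine ⟨fun h => ⟨?_, Or.inl χ.2, h⟩, fun h => h.2.2⟩
  rw [mem_preimage, mem_closedBall_zero_iff]
  exact ContinuousLinearMap.opNorm_le_bound _ zero_le_one fun c => by
    rw [one_mul]
    exact norm_character_apply_le χ c

theorem continuous_eval_character (c : C) : Continuous fun χ : characterSpace ℂ C => χ c :=
  (WeakDual.eval_continuous c).comp continuous_subtype_val

theorem exists_apply_ne_zero (χ : characterSpace ℂ C) : ∃ c, χ c ≠ 0 := by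
  by_contra! h
  exact χ.2.1 (DFunLike.ext _ _ h)

theorem locallyCompactSpace_characterSpace : LocallyCompactSpace (characterSpace ℂ C) := by
  have : WeaklyLocallyCompactSpace (characterSpace ℂ C) := ⟨fun χ => by
    obtain ⟨c, hc⟩ := exists_apply_ne_zero χ
    have hpos := norm_pos_iff.2 hc
    refine ⟨_, isCompact_setOf_le_norm_character c (half_pos hpos), ?_⟩
    filter_upwards [(continuous_eval_character c).norm.continuousAt.eventually
      (lt_mem_nhds (half_lt_self hpos))] with χ' h using h.le⟩
  infer_instance

variable {Y : Type*} [TopologicalSpace Y] [T2Space Y] [LocallyCompactSpace Y]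

theorem eq_of_forall_apply_eq {y y' : Y} (h : ∀ a : C₀(Y, ℂ), a y = a y') : y = y' :=
  evalCharacter_bijective.1 (DFunLike.ext _ _ h)

variable {ψ : C₀(Y, ℂ) →⋆ₙₐ[ℂ] C} (hψ : IsProperMorphism ψ)

theorem continuous_dualMap : Continuous (dualMap ψ hψ) := by
  refine continuous_iff_continuousAt.2 fun χ => tendsto_nhds.2 fun U hU hχ => ?_
  obtain ⟨a, ha, haU⟩ := exists_bump hU hχ
  rw [apply_dualMap] at ha
  filter_upwards [(continuous_eval_character (ψ a)).continuousAt.eventually_ne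
    (ha ▸ one_ne_zero)] with χ' h
  by_contra hU'
  exact h ((apply_dualMap ψ hψ χ' a).symm.trans (haU _ hU'))

theorem isProperMap_dualMap : IsProperMap (dualMap ψ hψ) := by
  refine isProperMap_iff_isCompact_preimage.2 ⟨continuous_dualMap hψ, fun K hK => ?_⟩
  obtain ⟨a, ha, -⟩ := exists_bump_of_isCompact hK
  refine (isCompact_setOf_le_norm_character (ψ a) one_pos).of_isClosed_subset
    (hK.isClosed.preimage (continuous_dualMap hψ)) fun χ hχ => ?_
  rw [mem_ofPred_eq, ← apply_dualMap ψ hψ, ha _ hχ, norm_one]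

/-- A proper map has closed range, so a missed point carries a bump vanishing on the range; `ψ`
would kill it. -/
theorem surjective_dualMap (hinj : Function.Injective ψ) : Function.Surjective (dualMap ψ hψ) := by
  intro y
  by_contra hy
  obtain ⟨a, ha, ha0⟩ := exists_bump (isProperMap_dualMap hψ).isClosed_range.isOpen_compl hy
  have h0 : ψ a = 0 := eq_zero_of_forall_character fun χ => by
    rw [← apply_dualMap ψ hψ]
    exact ha0 _ fun h => h ⟨χ, rfl⟩
  rw [hinj (h0.trans (map_zero ψ).symm)] at ha
  exact zero_ne_one ha

end Spectrum

theorem IsIdealInclusion.leftMul_mul {B C : Type*} [NonUnitalCStarAlgebra B]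
    [NonUnitalCStarAlgebra C] {j : B →⋆ₙₐ[ℂ] C} (h : IsIdealInclusion j) (c : C) (b b' : B) :
    h.leftMul c (b * b') = h.leftMul c b * b' :=
  h.injective <| by simp only [map_leftMul, map_mul, mul_assoc]

/-! ### From algebras to spaces -/

section Ideal

open WeakDual

variable {X C : Type*} [TopologicalSpace X] [T2Space X] [LocallyCompactSpace X]
  [NonUnitalCommCStarAlgebra C] {j : C₀(X, ℂ) →⋆ₙₐ[ℂ] C}

namespace IsIdealInclusion

/-- The character is `c ↦ (c e)(x)` for any `e` with `e x = 1`. Evaluating `(c e) b = (c b) e` at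
`x` gives the formula for every `b`. -/
theorem exists_character (h : IsIdealInclusion j) (x : X) :
    ∃ χ : characterSpace ℂ C, ∀ c b, h.leftMul c b x = χ c * b x := by
  obtain ⟨e, he, -⟩ := exists_bump isOpen_univ (mem_univ x)
  have key : ∀ c b, h.leftMul c b x = h.leftMul c e x * b x := fun c b => by
    have h1 := DFunLike.congr_fun (h.leftMul_mul c e b) x
    rw [mul_comm e b, leftMul_mul, ZeroAtInftyContinuousMap.mul_apply,
      ZeroAtInftyContinuousMap.mul_apply, he, mul_one] at h1
    exact h1
  let L : C →ₗ[ℂ] ℂ :=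
    { toFun := fun c => h.leftMul c e x
      map_add' := fun c d => by
        rw [← ZeroAtInftyContinuousMap.add_apply, show h.leftMul (c + d) e = h.leftMul c e +
          h.leftMul d e from h.injective (by simp only [map_leftMul, map_add, add_mul])]
      map_smul' := fun r c => by
        rw [RingHom.id_apply, ← ZeroAtInftyContinuousMap.smul_apply, show h.leftMul (r • c) e =
          r • h.leftMul c e from
            h.injective (by simp only [map_leftMul, map_smul, smul_mul_assoc])] }
  refine ⟨⟨StrongDual.toWeakDual (L.mkContinuous ‖e‖ fun c => ?_), fun h0 => ?_, fun c d => ?_⟩,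
    key⟩
  · refine (norm_character_apply_le (evalCharacter x) (h.leftMul c e)).trans ?_
    rw [← NonUnitalStarAlgHom.norm_map j h.injective, map_leftMul,
      ← NonUnitalStarAlgHom.norm_map j h.injective e, mul_comm ‖j e‖]
    exact norm_mul_le _ _
  · have h1 : h.leftMul (j e) e x = 0 := DFunLike.congr_fun h0 (j e)
    rw [show h.leftMul (j e) e = e * e from h.injective (by rw [map_leftMul, map_mul]),
      ZeroAtInftyContinuousMap.mul_apply, he, mul_one] at h1
    exact one_ne_zero h1
  · change h.leftMul (c * d) e x = h.leftMul c e x * h.leftMul d e x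
    rw [← key c (h.leftMul d e), show h.leftMul (c * d) e = h.leftMul c (h.leftMul d e) from
      h.injective (by simp only [map_leftMul, mul_assoc])]

/-- The map from `X` to the spectrum of `C` dual to an inclusion of `C₀(X)` as an ideal. -/
def toCharacter (h : IsIdealInclusion j) (x : X) : characterSpace ℂ C :=
  (h.exists_character x).choose

theorem leftMul_apply (h : IsIdealInclusion j) (c : C) (b : C₀(X, ℂ)) (x : X) :
    h.leftMul c b x = h.toCharacter x c * b x :=
  (h.exists_character x).choose_spec c b

theorem toCharacter_map (h : IsIdealInclusion j) (x : X) (b : C₀(X, ℂ)) :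
    h.toCharacter x (j b) = b x := by
  obtain ⟨e, he, -⟩ := exists_bump isOpen_univ (mem_univ x)
  have h1 := h.leftMul_apply (j b) e x
  rw [show h.leftMul (j b) e = b * e from h.injective (by rw [map_leftMul, map_mul]),
    ZeroAtInftyContinuousMap.mul_apply, he, mul_one, mul_one] at h1
  exact h1.symm

/-- On the ideal, `χ` is evaluation at some `x`; its other values are then determined by `χ (c * j
b) = χ c * χ (j b)`. -/
theorem mem_range_toCharacter (h : IsIdealInclusion j) {χ : characterSpace ℂ C} {b : C₀(X, ℂ)}
    (hb : χ (j b) ≠ 0) : χ ∈ range h.toCharacter := by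
  let χ' : characterSpace ℂ C₀(X, ℂ) :=
    ⟨StrongDual.toWeakDual ((CharacterSpace.toCLM χ).comp
      (LinearMap.mkContinuous (j : C₀(X, ℂ) →ₗ[ℂ] C) 1 fun a => by
        simpa using NonUnitalStarAlgHom.norm_apply_le j a)),
      fun h0 => hb (DFunLike.congr_fun h0 b),
      fun a a' => by
        change χ (j (a * a')) = χ (j a) * χ (j a')
        rw [map_mul, map_mul]⟩
  obtain ⟨x, hx⟩ := evalCharacter_bijective.2 χ'
  have hx' : ∀ b, χ (j b) = b x := fun b => (DFunLike.congr_fun hx b).symm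
  refine ⟨x, DFunLike.ext _ _ fun c => mul_right_cancel₀ hb ?_⟩
  rw [← map_mul, ← h.map_leftMul, hx', hx', leftMul_apply]

/-- Near `x`, the value at `c` is the quotient of continuous functions `(c e) / e`. -/
theorem continuous_toCharacter (h : IsIdealInclusion j) : Continuous h.toCharacter := by
  refine continuous_induced_rng.2 (WeakDual.continuous_of_continuous_eval fun c =>
    continuous_iff_continuousAt.2 fun x => ?_)
  obtain ⟨e, he, -⟩ := exists_bump isOpen_univ (mem_univ x)
  have hne : e x ≠ 0 := he ▸ one_ne_zero
  refine ((h.leftMul c e).continuous.continuousAt.div e.continuous.continuousAt hne).congr ?_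
  filter_upwards [e.continuous.continuousAt.eventually_ne hne] with x' hx'
  exact (div_eq_iff hx').2 (h.leftMul_apply c e x')

theorem isOpenEmbedding_toCharacter (h : IsIdealInclusion j) : IsOpenEmbedding h.toCharacter := by
  refine .of_continuous_injective_isOpenMap h.continuous_toCharacter (fun x x' hx => ?_)
    fun V hV => isOpen_iff_mem_nhds.2 ?_
  · exact eq_of_forall_apply_eq fun b => by rw [← h.toCharacter_map, hx, toCharacter_map]
  · rintro _ ⟨x, hx, rfl⟩
    obtain ⟨b, hb, hbV⟩ := exists_bump hV hx
    filter_upwards [(continuous_eval_character (j b)).continuousAt.eventually_ne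
      (show h.toCharacter x (j b) ≠ 0 by rw [toCharacter_map, hb]; exact one_ne_zero)] with χ hχ
    obtain ⟨x', rfl⟩ := h.mem_range_toCharacter hχ
    refine ⟨x', ?_, rfl⟩
    by_contra hx'
    exact hχ ((h.toCharacter_map x' b).trans (hbV x' hx'))

theorem mem_annihilator (h : IsIdealInclusion j) {c : C}
    (hc : ∀ χ ∈ range h.toCharacter, χ c = 0) : c ∈ annihilator (range j) := by
  rintro _ ⟨b, rfl⟩
  refine eq_zero_of_forall_character fun χ => ?_
  rw [map_mul]
  by_cases hb : χ (j b) = 0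
  · rw [hb, mul_zero]
  · rw [hc χ (h.mem_range_toCharacter hb), zero_mul]

variable {Y : Type*} [TopologicalSpace Y] [T2Space Y] [LocallyCompactSpace Y] {f : C(X, Y)}
  {ψ : C₀(Y, ℂ) →⋆ₙₐ[ℂ] C}

theorem dualMap_comp_toCharacter (h : IsIdealInclusion j) (hψ : IsProperMorphism ψ)
    (hf : h.inducedMorphism.comp ψ = pullback f) : dualMap ψ hψ ∘ h.toCharacter = f := by
  ext x
  refine eq_of_forall_apply_eq fun a => ?_
  obtain ⟨e, he, -⟩ := exists_bump isOpen_univ (mem_univ x)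
  have h1 : h.leftMul (ψ a) e x = a (f x) * e x :=
    congrArg (fun φ : C₀(Y, ℂ) →⋆ₙₐ[ℂ] 𝓜(ℂ, C₀(X, ℂ)) => (φ a).fst e x) hf
  rw [leftMul_apply, he, mul_one, mul_one] at h1
  rw [Function.comp_apply, apply_dualMap, h1]

/-- A bump `c` supported in `V` lies in `B^⊥`, so `ψ a = c` modulo `B`. Characters outside the image
of `X` kill `B`, so there `a` takes the values of `c`. -/
theorem exists_bump_dualMap (h : IsIdealInclusion j) (hψ : IsProperMorphism ψ)
    (hann : ∀ c ∈ annihilator (range j), ∃ a ∈ pimsnerIdeal (pullback f), ψ a - c ∈ range j)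
    {V : Set (characterSpace ℂ C)} (hV : IsOpen V) (hVr : V ⊆ (closure (range h.toCharacter))ᶜ)
    {χ : characterSpace ℂ C} (hχ : χ ∈ V) :
    ∃ a ∈ pimsnerIdeal (pullback f), a (dualMap ψ hψ χ) = 1 ∧
      ∀ χ' ∉ range h.toCharacter, χ' ∉ V → a (dualMap ψ hψ χ') = 0 := by
  obtain ⟨c, hc1, hc0⟩ := exists_bump_character hV hχ
  obtain ⟨a, ha, b, hb⟩ := hann c <| h.mem_annihilator fun χ' hχ' =>
    hc0 χ' fun hV' => hVr hV' (subset_closure hχ')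
  have key : ∀ χ' ∉ range h.toCharacter, a (dualMap ψ hψ χ') = χ' c := fun χ' hχ' => by
    rw [apply_dualMap, ← sub_eq_zero, ← map_sub, ← hb]
    by_contra hne
    exact hχ' (h.mem_range_toCharacter hne)
  exact ⟨a, ha, (key χ fun hr => hVr hχ (subset_closure hr)).trans hc1,
    fun χ' hχ' hV' => (key χ' hχ').trans (hc0 χ' hV')⟩

end IsIdealInclusion

theorem mem_pr_of_mem_pimsnerIdeal {Y : Type*} [TopologicalSpace Y] {f : C(X, Y)}
    {a : C₀(Y, ℂ)} (ha : a ∈ pimsnerIdeal (pullback f)) {y : Y} (hy : a y = 1) :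
    y ∈ pr f := by
  obtain ⟨b, hb⟩ := exists_of_mem_pimsnerIdeal_pullback ha
  have hsub : closure {y | 1 / 2 < ‖a y‖} ⊆ {y | 1 / 2 ≤ ‖a y‖} :=
    closure_minimal (fun y (hy : 1 / 2 < ‖a y‖) => hy.le) (isClosed_le continuous_const a.continuous.norm)
  -- Any threshold strictly between `0` and `1` would serve: the closure stays in a superlevel set
  -- of `a`, whose preimage is one of `a ∘ f ∈ C₀(X)`.
  refine ⟨{y | 1 / 2 < ‖a y‖}, ⟨isOpen_lt continuous_const a.continuous.norm,
    (isCompact_setOf_le_norm a one_half_pos).of_isClosed_subset isClosed_closure hsub,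
    (isCompact_setOf_le_norm b one_half_pos).of_isClosed_subset
      (isClosed_closure.preimage f.continuous) fun x hx => ?_⟩, ?_⟩
  · rw [mem_ofPred_eq, hb]
    exact hsub hx
  · rw [mem_ofPred_eq, hy, norm_one]
    exact one_half_lt_one

variable {Y : Type*} [TopologicalSpace Y] [T2Space Y] [LocallyCompactSpace Y] {f : C(X, Y)}
  {ψ : C₀(Y, ℂ) →⋆ₙₐ[ℂ] C}

theorem IsNCFibrewiseCompactification.isFibrewiseCompactification
    (hψ : IsNCFibrewiseCompactification (pullback f) ψ) :
    IsFibrewiseCompactification f (dualMap ψ hψ.isProperMorphism) := by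
  obtain ⟨j, h, hf, hann⟩ := hψ.exists_idealInclusion
  have hp := hψ.isProperMorphism
  have hg := isProperMap_dualMap hp
  have hgi := h.dualMap_comp_toCharacter hp hf
  have hO : IsOpen (closure (range h.toCharacter))ᶜ := isClosed_closure.isOpen_compl
  have hnr : ∀ χ ∈ (closure (range h.toCharacter))ᶜ, χ ∉ range h.toCharacter :=
    fun χ hχ hr => hχ (subset_closure hr)
  refine ⟨inferInstance, locallyCompactSpace_characterSpace, hg, h.toCharacter,
    h.isOpenEmbedding_toCharacter, hgi, ⟨isInducing_iff_nhds.2 fun χ => ?_, ?_⟩, ?_, ?_⟩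
  · refine le_antisymm
      ((hg.continuous.comp continuous_subtype_val).tendsto χ).le_comap fun V hV => ?_
    obtain ⟨V', hV', hVV'⟩ := mem_nhds_subtype _ _ _ |>.1 hV
    obtain ⟨U, hUV', hU, hχ⟩ := mem_nhds_iff.1 hV'
    obtain ⟨a, -, ha1, ha0⟩ := h.exists_bump_dualMap hp hann (hU.inter hO) inter_subset_right
      ⟨hχ, χ.2⟩
    refine ⟨{y | a y ≠ 0}, (isOpen_ne_fun a.continuous continuous_const).mem_nhds
      (show a (dualMap ψ hp χ) ≠ 0 from ha1 ▸ one_ne_zero), fun χ' hχ' => hVV' (hUV' ?_)⟩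
    by_contra hU'
    exact hχ' (ha0 χ' (hnr _ χ'.2) fun hmem => hU' hmem.1)
  · intro χ χ' hχ
    by_contra hne
    obtain ⟨a, -, ha1, ha0⟩ := h.exists_bump_dualMap hp hann
      (hO.inter (isOpen_compl_singleton (x := (χ' : characterSpace ℂ C)))) inter_subset_left
      ⟨χ.2, fun h => hne (Subtype.ext h)⟩
    have h1 := ha0 χ' (hnr _ χ'.2) fun hmem => hmem.2 rfl
    rw [domRestrict_apply, domRestrict_apply] at hχ
    rw [← hχ, ha1] at h1
    exact one_ne_zero h1
  · rintro _ ⟨χ, hχ, rfl⟩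
    obtain ⟨a, ha, ha1, -⟩ := h.exists_bump_dualMap hp hann hO subset_rfl hχ
    exact mem_pr_of_mem_pimsnerIdeal ha ha1
  -- The image of the complement of `X` is closed because proper maps are closed. Inside `pr f` it
  -- equals the required image, as boundary points do not lie over `pr f`.
  · have hE : IsClosed (dualMap ψ hp '' (range h.toCharacter)ᶜ) :=
      hg.isClosedMap _ h.isOpenEmbedding_toCharacter.isOpen_range.isClosed_compl
    convert hE.preimage (continuous_subtype_val (p := (· ∈ pr f))) using 1
    ext ⟨y, hy⟩
    constructor
    · rintro ⟨χ, hχ, hχy⟩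
      exact ⟨χ, hnr χ hχ, hχy⟩
    · rintro ⟨χ, hχ, rfl⟩
      exact ⟨χ, fun hcl => hχ (mem_range_of_mem_closure_of_mem_pr h.continuous_toCharacter
        hg.continuous hgi hcl hy), rfl⟩

theorem IsNCPerfection.isPerfection (hψ : IsNCPerfection (pullback f) ψ) :
    IsPerfection f (dualMap ψ hψ.isProperMorphism) :=
  ⟨hψ.isFibrewiseCompactification, surjective_dualMap hψ.isProperMorphism hψ.injective⟩

end Ideal

theorem IsNCFibrewiseCompactification.mul_comm {X Y C : Type*} [TopologicalSpace X]
    [TopologicalSpace Y] [NonUnitalCStarAlgebra C] {f : C(X, Y)} {ψ : C₀(Y, ℂ) →⋆ₙₐ[ℂ] C}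
    (hψ : IsNCFibrewiseCompactification (pullback f) ψ) (c d : C) : c * d = d * c := by
  obtain ⟨j, h, -, hann⟩ := hψ.exists_idealInclusion
  exact mul_comm_of_exists h _root_.mul_comm _root_.mul_comm hann c d

section Commutative

variable {X Y C : Type*} [TopologicalSpace X] [T2Space X] [LocallyCompactSpace X]
  [TopologicalSpace Y] [T2Space Y] [LocallyCompactSpace Y] [NonUnitalCStarAlgebra C]
  {f : C(X, Y)} {ψ : C₀(Y, ℂ) →⋆ₙₐ[ℂ] C}

theorem IsNCFibrewiseCompactification.isFibrewiseCompactification_dualMap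
    (hψ : IsNCFibrewiseCompactification (pullback f) ψ) :
    IsFibrewiseCompactification f (dualMap ψ hψ.isProperMorphism) :=
  -- Keeping the given structure and adding only commutativity lets the commutative result apply to
  -- the same `ψ`.
  letI : NonUnitalCommCStarAlgebra C :=
    { ‹NonUnitalCStarAlgebra C› with mul_comm := hψ.mul_comm }
  isFibrewiseCompactification hψ

theorem IsNCPerfection.isPerfection_dualMap (hψ : IsNCPerfection (pullback f) ψ) :
    IsPerfection f (dualMap ψ hψ.isProperMorphism) :=
  letI : NonUnitalCommCStarAlgebra C :=
    { ‹NonUnitalCStarAlgebra C› with mul_comm := hψ.mul_comm }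
  isPerfection hψ

end Commutative

end FibrewiseCompactification
end

theorem mainTheorem7 {X : Type*} {Y : Type*}
    [TopologicalSpace X] [T2Space X] [LocallyCompactSpace X]
    [TopologicalSpace Y] [T2Space Y] [LocallyCompactSpace Y] (f : C(X, Y)) :
    FibrewiseCompactification.IsMorphism (FibrewiseCompactification.pullback f) ∧
    (∀ (Z : Type*) [TopologicalSpace Z] (g : Z → Y),
      (∀ hg : FibrewiseCompactification.IsFibrewiseCompactification f g,
        FibrewiseCompactification.IsNCFibrewiseCompactification
          (FibrewiseCompactification.pullback f)
          (FibrewiseCompactification.properPullback g hg.isProperMap)) ∧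
      (∀ hg : FibrewiseCompactification.IsPerfection f g,
        FibrewiseCompactification.IsNCPerfection
          (FibrewiseCompactification.pullback f)
          (FibrewiseCompactification.properPullback g hg.isProperMap))) ∧
    (∀ (C : Type*) [NonUnitalCStarAlgebra C] (ψ : C₀(Y, ℂ) →⋆ₙₐ[ℂ] C),
      (∀ hψ : FibrewiseCompactification.IsNCFibrewiseCompactification
          (FibrewiseCompactification.pullback f) ψ,
        (∀ c d : C, c * d = d * c) ∧
        FibrewiseCompactification.IsFibrewiseCompactification f
          (FibrewiseCompactification.dualMap ψ hψ.isProperMorphism)) ∧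
      (∀ hψ : FibrewiseCompactification.IsNCPerfection
          (FibrewiseCompactification.pullback f) ψ,
        (∀ c d : C, c * d = d * c) ∧
        FibrewiseCompactification.IsPerfection f
          (FibrewiseCompactification.dualMap ψ hψ.isProperMorphism))) := by
  refine ⟨FibrewiseCompactification.isMorphism_pullback f, fun Z _ g => ⟨fun hg => ?_, fun hg => ?_⟩,
    fun C _ ψ => ⟨fun hψ => ?_, fun hψ => ?_⟩⟩
  · have := hg.t2Space
    exact hg.isNCFibrewiseCompactification
  · have := hg.t2Space
    exact ⟨hg.isNCFibrewiseCompactification,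
      FibrewiseCompactification.injective_properPullback hg.isProperMap hg.surjective⟩
  · exact ⟨hψ.mul_comm, hψ.isFibrewiseCompactification_dualMap⟩
  · exact ⟨hψ.mul_comm, hψ.isPerfection_dualMap⟩
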